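/- Let $q\ge 2$ be an integer and let $\mathcal Q=(\mathcal P,\mathcal L,\mathrm I)$ be a generalized quadrangle of order $(q,q)$, i.e. an incidence structure with nonempty sets of points and lines in which every line is incident with exactly $q+1$ points, every point is incident with exactly $q+1$ lines, two distinct points are incident with at most one common line, and for every non-incident point-line pair $(x,\ell)$ there is a unique pair $(m,y)\in\mathcal L\times\mathcal P$ with $x\,\mathrm I\,m\,\mathrm I\,y\,\mathrm I\,\ell$. Let $P$ be a point and let $e_0$ be a line through $P$. Delete $P$, all points incident with some line through $P$, and all lines incident with some point of $e_0$ (including $e_0$ itself). Let $\mathcal C_q$ be the incidence graph of the remaining points and lines: its vertices are these points and lines, and a point is adjacent to a line exactly when they are incident. Then $\mathcal C_q$ is a finite $q$-regular graph with exactly $2q^3$ vertices and girth $8$, and every edge of $\mathcal C_q$ is contained in exactly $(q-1)^2\bigl((q-2)^2+1\bigr)$ distinct $8$-cycles; that is, $\mathcal C_q$ is an $egr\bigl(2q^3,\,q,\,8,\,(q-1)^2((q-2)^2+1)\bigr)$. In particular, if a generalized quadrangle of order $(q,q)$ exists, then there exists an $egr\bigl(2q^3,\,q,\,8,\,(q-1)^2((q-2)^2+1)\bigr)$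 graph. -/

import Mathlib

universe u v

/-- The incidence structure with point set `Pt`, line set `Ln` and incidence relation `I` is a
generalized quadrangle of order `(s, t)`: every line carries exactly `s + 1` points, every point
lies on exactly `t + 1` lines, two distinct points lie on at most one common line (equivalently,
two distinct lines meet in at most one point), and for every non-incident point-line pair `(x, l)`
there is a unique pair `(m, y)` with `x I m I y I l`. -/
structure IsGeneralizedQuadrangle {Pt : Type u} {Ln : Type v} (I : Pt → Ln → Prop) (s t : ℕ) :
    Prop where
  nonempty_points : Nonempty Pt
  nonempty_lines : Nonempty Ln
  one_le_s : 1 ≤ s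
  one_le_t : 1 ≤ t
  points_on_line : ∀ l : Ln, {x : Pt | I x l}.ncard = s + 1
  lines_through_point : ∀ x : Pt, {l : Ln | I x l}.ncard = t + 1
  eq_or_eq : ∀ (x y : Pt) (l m : Ln), I x l → I y l → I x m → I y m → x = y ∨ l = m
  existsUnique_proj : ∀ (x : Pt) (l : Ln), ¬ I x l →
    ∃! p : Ln × Pt, I x p.1 ∧ I p.2 p.1 ∧ I p.2 l

/-- The incidence (Levi) graph: vertices are the points and the lines, and a point is adjacent to
a line exactly when they are incident. -/
def incidenceGraph {Pt : Type u} {Ln : Type v} (I : Pt → Ln → Prop) : SimpleGraph (Pt ⊕ Ln) where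
  Adj
    | Sum.inl x, Sum.inr l => I x l
    | Sum.inr l, Sum.inl x => I x l
    | _, _ => False
  symm := ⟨by
    rintro (x | l) (y | m) h
    · exact h
    · exact h
    · exact h
    · exact h⟩
  loopless := ⟨by
    rintro (x | l) h
    · exact h
    · exact h⟩

/-- What is left after deleting the point `P`, all points on the lines through `P`, and all lines
incident with some point of the line `e₀`. -/
def remaining {Pt : Type u} {Ln : Type v} (I : Pt → Ln → Prop) (P : Pt) (e₀ : Ln) :
    Set (Pt ⊕ Ln) :=
  {w | (∃ x : Pt, w = Sum.inl x ∧ x ≠ P ∧ ∀ l : Ln, I P l → ¬ I x l) ∨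
    (∃ m : Ln, w = Sum.inr m ∧ ∀ x : Pt, I x e₀ → ¬ I x m)}

/-- The incidence graph of the structure that is left after the deletion. -/
def deletedGraph {Pt : Type u} {Ln : Type v} (I : Pt → Ln → Prop) (P : Pt) (e₀ : Ln) :
    SimpleGraph (remaining I P e₀) :=
  (incidenceGraph I).induce (remaining I P e₀)

/-- The cycles of length `g` of `G`, each one taken as a subgraph, so that neither a starting
vertex nor an orientation is recorded. -/
def cyclesOfLength {V : Type u} (G : SimpleGraph V) (g : ℕ) : Set G.Subgraph :=
  {C | ∃ (a : V) (w : G.Walk a a), w.IsCycle ∧ w.length = g ∧ w.toSubgraph = C}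

/-- `G` is an `egr(n, k, g, lam)`: a finite `k`-regular graph of order `n` and girth `g`, each of
whose edges is contained in exactly `lam` distinct cycles of length `g`. -/
structure IsEdgeGirthRegular {V : Type u} (G : SimpleGraph V) (n k g lam : ℕ) : Prop where
  finite : Finite V
  order : Nat.card V = n
  regular : ∀ a : V, (G.neighborSet a).ncard = k
  girth : G.egirth = (g : ℕ∞)
  cycles_through_edge : ∀ e ∈ G.edgeSet, {C ∈ cyclesOfLength G g | e ∈ C.edgeSet}.ncard = lam

/-!
Call two points *opposite* if they are not collinear, and dually two lines if they do not meet. The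
vertices that are kept are the points opposite to `P` and the lines opposite to `e₀`. This
description is self-dual, so that every count of points also yields the dual count of lines.

A generalized quadrangle contains no triangles, hence the girth is at least `8`. To count the
`8`-cycles through a flag `x I l` for order `(s, t)`, choose a line `m ≠ l` through `x` and a point
`y ≠ x` on `m`, which is possible in `(t - 1) * (s - 1)` ways, and then a point `a ≠ x` on `l` and
a line `n ≠ m` through `y`, again in `(s - 1) * (t - 1)` ways. In the whole quadrangle there are a
unique line `k` and a unique point `b` with `a I k I b I n`, and they close an octagon. It is lost
if `k` meets `e₀` or `b` is collinear with `P`. If `k` meets `e₀`, then `k` is determined by `a`,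
and `n` by `k` and `y`; exactly one of the `s - 1` points `a` does not occur, namely the one that is
collinear with the point of `e₀` collinear with `y`. Hence `s - 2` pairs `(a, n)` are lost in this
way, and dually `t - 2` in the other. No pair is lost twice, as `P`, `b` and `k ∩ e₀` would form a
triangle, so that `(s - 1) * (t - 1) - (s - 2) - (t - 2) = (s - 2) * (t - 2) + 1` pairs remain.
-/

section Counting

variable {α β : Type*} [Finite α] [Finite β] {A : Set α} {B : Set β}

theorem ncard_mul_eq_ncard_mul (r : α → β → Prop) {m n : ℕ}
    (hA : ∀ a ∈ A, {b ∈ B | r a b}.ncard = m) (hB : ∀ b ∈ B, {a ∈ A | r a b}.ncard = n) :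
    A.ncard * m = B.ncard * n := by
  classical
  have := Fintype.ofFinite α
  have := Fintype.ofFinite β
  simp only [Set.ncard_eq_toFinset_card', Set.toFinset_ofPred] at hA hB ⊢
  refine Finset.card_mul_eq_card_mul r (fun a ha => ?_) fun b hb => ?_
  · rw [← hA a (Set.mem_toFinset.1 ha), Finset.bipartiteAbove]
    congr 1
    grind
  · rw [← hB b (Set.mem_toFinset.1 hb), Finset.bipartiteBelow]
    congr 1
    grind

theorem ncard_eq_ncard_mul_of_fiber {f : α → β} {k : ℕ} (hf : Set.MapsTo f A B)
    (hfiber : ∀ b ∈ B, {a ∈ A | f a = b}.ncard = k) : A.ncard = B.ncard * k := by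
  have hsingle (a) (ha : a ∈ A) : {b ∈ B | f a = b} = {f a} := by
    have := hf ha
    grind
  rw [← ncard_mul_eq_ncard_mul (fun a b => f a = b)
    (fun a ha => by rw [hsingle a ha, Set.ncard_singleton]) hfiber, mul_one]

end Counting

section Cycles

variable {V : Type u} {W : Type v} {G : SimpleGraph V} {H : SimpleGraph W}

theorem isCycle_eq_of_toSubgraph_eq {u : V} {w w' : G.Walk u u} (hw : w.IsCycle)
    (hw' : w'.IsCycle) (hlen : w.length = w'.length) (hsnd : w.snd = w'.snd)
    (hsub : w.toSubgraph = w'.toSubgraph) : w = w' := by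
  have hconsecutive (k : ℕ) (hk : k + 1 ≤ w.length) :
      w.getVert k = w'.getVert k ∧ w.getVert (k + 1) = w'.getVert (k + 1) := by
    induction k with
    | zero => exact ⟨by simp only [SimpleGraph.Walk.getVert_zero], hsnd⟩
    | succ k ih =>
      obtain ⟨hprev, hcur⟩ := ih (by omega)
      refine ⟨hcur, ?_⟩
      have hnbhd := hw.neighborSet_toSubgraph_internal (i := k + 1) (by omega) (by omega)
      have hnbhd' := hw'.neighborSet_toSubgraph_internal (i := k + 1) (by omega) (by omega)
      have hne := hw.getVert_sub_one_ne_getVert_add_one (i := k + 1) (by omega)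
      rw [hsub, hcur, hnbhd', Nat.add_sub_cancel, hprev] at hnbhd
      rw [Nat.add_sub_cancel, hprev] at hne
      grind
  refine SimpleGraph.Walk.ext_getVert_le_length hlen fun k hk => ?_
  cases k with
  | zero => simp only [SimpleGraph.Walk.getVert_zero]
  | succ k => exact (hconsecutive k hk).2

theorem ncard_cyclesOfLength_through (u v : V) (g : ℕ) :
    {C ∈ cyclesOfLength G g | s(u, v) ∈ C.edgeSet}.ncard =
      {w : G.Walk u u | w.IsCycle ∧ w.length = g ∧ w.snd = v}.ncard := by
  classical
  refine (Set.ncard_congr (fun w _ => w.toSubgraph) ?_ ?_ ?_).symm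
  · rintro w ⟨hw, hlen, rfl⟩
    exact ⟨⟨u, w, hw, hlen, rfl⟩, w.toSubgraph_adj_snd hw.not_nil⟩
  · rintro w w' ⟨hw, hlen, hsnd⟩ ⟨hw', hlen', hsnd'⟩ hsub
    exact isCycle_eq_of_toSubgraph_eq hw hw' (hlen.trans hlen'.symm) (hsnd.trans hsnd'.symm) hsub
  · rintro C ⟨⟨a, w, hw, hlen, rfl⟩, huv⟩
    have hu : u ∈ w.support := w.fst_mem_support_of_mem_edges (w.mem_edges_toSubgraph.1 huv)
    have hcycle := hw.rotate hu
    have hlen' : (w.rotate u hu).length = g := by rw [SimpleGraph.Walk.length_rotate, hlen]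
    have hv : v ∈ (w.rotate u hu).toSubgraph.neighborSet u := by
      rw [w.toSubgraph_rotate hu]
      exact huv
    rw [hcycle.neighborSet_toSubgraph_endpoint] at hv
    rcases hv with rfl | rfl
    · exact ⟨_, ⟨hcycle, hlen', rfl⟩, w.toSubgraph_rotate hu⟩
    · refine ⟨_, ⟨hcycle.reverse, by rwa [SimpleGraph.Walk.length_reverse],
        SimpleGraph.Walk.snd_reverse _⟩, ?_⟩
      rw [SimpleGraph.Walk.toSubgraph_reverse, w.toSubgraph_rotate hu]

theorem map_mem_cyclesOfLength {f : G →g H} (hf : Function.Injective f) {C : G.Subgraph} {g : ℕ}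
    (hC : C ∈ cyclesOfLength G g) : C.map f ∈ cyclesOfLength H g := by
  obtain ⟨a, w, hw, hlen, rfl⟩ := hC
  exact ⟨f a, w.map f, hw.map hf, by rw [SimpleGraph.Walk.length_map, hlen], w.toSubgraph_map f⟩

theorem subgraph_map_symm_map (f : G ≃g H) (C : H.Subgraph) :
    (C.map f.symm.toHom).map f.toHom = C := by
  rw [← SimpleGraph.Subgraph.map_comp]
  convert C.map_id
  ext
  exact f.apply_symm_apply _

theorem ncard_cyclesOfLength_through_map (f : G ≃g H) (g : ℕ) (e : Sym2 V) :
    {C ∈ cyclesOfLength G g | e ∈ C.edgeSet}.ncard =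
      {C ∈ cyclesOfLength H g | e.map f ∈ C.edgeSet}.ncard := by
  refine Set.ncard_congr (fun C _ => C.map f.toHom) ?_ ?_ ?_
  · rintro C ⟨hC, he⟩
    refine ⟨map_mem_cyclesOfLength f.injective hC, ?_⟩
    rw [SimpleGraph.Subgraph.edgeSet_map]
    exact ⟨e, he, rfl⟩
  · intro C D _ _ hCD
    rw [← subgraph_map_symm_map f.symm C, ← subgraph_map_symm_map f.symm D]
    exact congrArg _ hCD
  · rintro C ⟨hC, he⟩
    refine ⟨C.map f.symm.toHom, ⟨map_mem_cyclesOfLength f.symm.injective hC, ?_⟩,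
      subgraph_map_symm_map f C⟩
    rw [SimpleGraph.Subgraph.edgeSet_map]
    refine ⟨_, he, ?_⟩
    have hleft : f.symm.toHom ∘ f = id := funext f.symm_apply_apply
    rw [Sym2.map_map, hleft, Sym2.map_id, id]

theorem IsEdgeGirthRegular.of_iso {n k g lam : ℕ} (hH : IsEdgeGirthRegular H n k g lam)
    (f : G ≃g H) : IsEdgeGirthRegular G n k g lam where
  finite := have := hH.finite; Finite.of_equiv W f.toEquiv.symm
  order := (Nat.card_congr f.toEquiv).trans hH.order
  regular a := (Nat.card_congr (f.mapNeighborSet a)).trans (hH.regular (f a))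
  girth := f.egirth_eq.trans hH.girth
  cycles_through_edge e he := (ncard_cyclesOfLength_through_map f g e).trans
    (hH.cycles_through_edge _ (f.map_mem_edgeSet_iff.2 he))

end Cycles

section Incidence

open SimpleGraph.Walk

variable {Pt : Type u} {Ln : Type v} {I : Pt → Ln → Prop}

/-- Any three points `x`, `y`, `z` and lines `l ∋ x, y`, `m ∋ y, z`, `n ∋ z, x` are degenerate.
The choice `z = x`, `n = m` shows that two points on two lines are degenerate as well, so that
this says that the incidence graph has girth at least `8`. -/
def NoTriangles (I : Pt → Ln → Prop) : Prop :=
  ∀ ⦃x y z : Pt⦄ ⦃l m n : Ln⦄, I x l → I y l → I y m → I z m → I z n → I x n →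
    x = y ∨ l = m ∨ l = n

/-- The sequence `a`, `l`, `x`, `m`, `y`, `n` is a path without backtracking in the incidence
graph. Paths of this length start at a point and end at a line, so that they are self-dual. -/
structure IsIncidencePath (I : Pt → Ln → Prop) (a : Pt) (l : Ln) (x : Pt) (m : Ln) (y : Pt)
    (n : Ln) : Prop where
  a_mem_l : I a l
  x_mem_l : I x l
  x_mem_m : I x m
  y_mem_m : I y m
  y_mem_n : I y n
  a_ne_x : a ≠ x
  l_ne_m : l ≠ m
  x_ne_y : x ≠ y
  m_ne_n : m ≠ n

/-- The ways to complete the flag `x I l` to an ordinary quadrangle: its consecutive elements are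
`x`, `l`, `a`, `k`, `b`, `n`, `y`, `m`. -/
@[ext]
structure Octagon (I : Pt → Ln → Prop) (x : Pt) (l : Ln) where
  (a b y : Pt)
  (k n m : Ln)
  a_mem_l : I a l
  a_mem_k : I a k
  b_mem_k : I b k
  b_mem_n : I b n
  y_mem_n : I y n
  y_mem_m : I y m
  x_mem_m : I x m
  points_nodup : [x, a, b, y].Nodup
  lines_nodup : [l, k, n, m].Nodup

theorem even_length_of_closed_walk {u : Pt ⊕ Ln} (w : (incidenceGraph I).Walk u u) :
    Even w.length := by
  let sides : (incidenceGraph I).Coloring Bool := .mk Sum.isLeft (by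
    rintro (x | l) (y | m) h
    exacts [h.elim, Bool.noConfusion, Bool.noConfusion, h.elim])
  exact (sides.even_length_iff_congr w).2 Iff.rfl

theorem adj_inl_inr {x : Pt} {l : Ln} (hxl : I x l) : (incidenceGraph I).Adj (.inl x) (.inr l) :=
  hxl

theorem adj_inr_inl {x : Pt} {l : Ln} (hxl : I x l) : (incidenceGraph I).Adj (.inr l) (.inl x) :=
  hxl

/-- The walk which goes from the point `x` via the line `l` to the point `y` and continues with
`w`. -/
abbrev consLine {x y : Pt} {l : Ln} {u : Pt ⊕ Ln} (hx : I x l) (hy : I y l)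
    (w : (incidenceGraph I).Walk (.inl y) u) : (incidenceGraph I).Walk (.inl x) u :=
  cons (adj_inl_inr hx) (cons (adj_inr_inl hy) w)

theorem exists_eq_consLine {x : Pt} {u : Pt ⊕ Ln} {n : ℕ}
    (w : (incidenceGraph I).Walk (.inl x) u) (hlen : w.length = n + 2) :
    ∃ (l : Ln) (y : Pt) (hx : I x l) (hy : I y l) (w' : (incidenceGraph I).Walk (.inl y) u),
      w = consLine hx hy w' ∧ w'.length = n := by
  match w with
  | cons (v := .inr l) hx (cons (v := .inl y) hy w') =>
    exact ⟨l, y, hx, hy, w', rfl, by simpa only [length_cons, Nat.add_right_cancel_iff] using hlen⟩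

theorem exists_eq_consLine_nil {x y : Pt} (w : (incidenceGraph I).Walk (.inl x) (.inl y))
    (hlen : w.length = 2) : ∃ (l : Ln) (hx : I x l) (hy : I y l), w = consLine hx hy nil := by
  obtain ⟨l, z, hx, hz, w', rfl, hlen'⟩ := exists_eq_consLine w hlen
  obtain rfl : z = y := Sum.inl_injective (eq_of_length_eq_zero hlen')
  obtain rfl : w' = nil := eq_nil_iff_nil.2 (length_eq_zero_iff.1 hlen')
  exact ⟨l, hx, hz, rfl⟩

namespace NoTriangles

theorem eq_or_eq (hI : NoTriangles I) {x y : Pt} {l m : Ln} (hxl : I x l) (hyl : I y l)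
    (hxm : I x m) (hym : I y m) : x = y ∨ l = m := by
  simpa only [or_self] using hI hxl hyl hym hxm hxm hxm

protected theorem flip (hI : NoTriangles I) : NoTriangles (flip I) := by
  intro l m n x y z hlx hmx hmy hny hnz hlz
  have := hI hlx hlz hnz hny hmy hmx
  have := hI hmx hmy hny hnz hlz hlx
  grind

theorem eight_le_length_of_point (hI : NoTriangles I) {x : Pt}
    (w : (incidenceGraph I).Walk (.inl x) (.inl x)) (hw : w.IsCycle) : 8 ≤ w.length := by
  have heven := even_length_of_closed_walk w
  have hthree := hw.three_le_length
  have hnodup := hw.support_nodup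
  by_contra! hlt
  obtain hfour | hsix : w.length = 2 + 2 ∨ w.length = 4 + 2 := by grind
  · obtain ⟨l, y, hxl, hyl, w₂, rfl, hlen₂⟩ := exists_eq_consLine w hfour
    obtain ⟨m, hym, hxm, rfl⟩ := exists_eq_consLine_nil w₂ hlen₂
    have := hI.eq_or_eq hxl hyl hxm hym
    simp only [support_cons, support_nil, List.tail_cons] at hnodup
    grind
  · obtain ⟨l, y, hxl, hyl, w₄, rfl, hlen₄⟩ := exists_eq_consLine w hsix
    obtain ⟨m, z, hym, hzm, w₂, rfl, hlen₂⟩ := exists_eq_consLine w₄ hlen₄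
    obtain ⟨n, hzn, hxn, rfl⟩ := exists_eq_consLine_nil w₂ hlen₂
    have := hI hxl hyl hym hzm hzn hxn
    simp only [support_cons, support_nil, List.tail_cons] at hnodup
    grind

theorem eight_le_egirth (hI : NoTriangles I) : 8 ≤ (incidenceGraph I).egirth := by
  classical
  refine SimpleGraph.le_egirth.2 fun u w hw => ?_
  suffices 8 ≤ w.length by exact_mod_cast this
  match u, w with
  | .inl x, w => exact hI.eight_le_length_of_point w hw
  | .inr l, cons (v := .inl x) hx w =>
    have hmem : .inl x ∈ (cons hx w).support := List.mem_cons_of_mem _ w.start_mem_support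
    rw [← length_rotate _ _ hmem]
    exact hI.eight_le_length_of_point _ (hw.rotate hmem)

end NoTriangles

namespace IsIncidencePath

variable {a b x y : Pt} {k l m n : Ln}

protected theorem dual (hp : IsIncidencePath I a l x m y n) :
    IsIncidencePath (flip I) n y m x l a where
  a_mem_l := hp.y_mem_n
  x_mem_l := hp.y_mem_m
  x_mem_m := hp.x_mem_m
  y_mem_m := hp.x_mem_l
  y_mem_n := hp.a_mem_l
  a_ne_x := hp.m_ne_n.symm
  l_ne_m := hp.x_ne_y.symm
  x_ne_y := hp.l_ne_m.symm
  m_ne_n := hp.a_ne_x.symm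

theorem not_mem_ends (hp : IsIncidencePath I a l x m y n) (hI : NoTriangles I) : ¬ I a n := by
  intro han
  have := hI hp.a_mem_l hp.x_mem_l hp.x_mem_m hp.y_mem_m hp.y_mem_n han
  have := hI.eq_or_eq hp.x_mem_l (y := y) (l := l) (m := m)
  grind [IsIncidencePath]

theorem points_nodup (hp : IsIncidencePath I a l x m y n) (hI : NoTriangles I) (hak : I a k)
    (hbk : I b k) (hbn : I b n) : [x, a, b, y].Nodup := by
  obtain ⟨hal, hxl, hxm, hym, hyn, hax, hlm, hxy, hmn⟩ := hp
  have hyl : ¬ I y l := fun hyl => by grind [hI.eq_or_eq hyl hxl hym hxm]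
  have hbx : b ≠ x := by rintro rfl; grind [hI.eq_or_eq hyn hbn hym hxm]
  have hba : b ≠ a := by rintro rfl; grind [hI hal hxl hxm hym hyn hbn]
  have hby : b ≠ y := by rintro rfl; grind [hI hal hxl hxm hym hbk hak]
  grind

theorem lines_nodup (hp : IsIncidencePath I a l x m y n) (hI : NoTriangles I) (hak : I a k)
    (hbk : I b k) (hbn : I b n) : [l, k, n, m].Nodup :=
  List.nodup_reverse.1 (hp.dual.points_nodup hI.flip hbn hbk hak)

end IsIncidencePath

namespace Octagon

variable {x : Pt} {l : Ln}

instance [Finite Pt] [Finite Ln] : Finite (Octagon I x l) :=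
  Finite.of_injective (fun o => ((o.a, o.b, o.y), (o.k, o.n, o.m))) fun o o' h => by
    simp only [Prod.mk.injEq] at h
    obtain ⟨⟨ha, hb, hy⟩, hk, hn, hm⟩ := h
    exact Octagon.ext ha hb hy hk hn hm

theorem isIncidencePath (o : Octagon I x l) (hxl : I x l) :
    IsIncidencePath I o.a l x o.m o.y o.n := by
  have hpoints := o.points_nodup
  have hlines := o.lines_nodup
  exact ⟨o.a_mem_l, hxl, o.x_mem_m, o.y_mem_m, o.y_mem_n, by grind, by grind, by grind, by grind⟩

/-- The closed walk around an octagon which starts at `x` and proceeds to `l`. -/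
def toWalk (hxl : I x l) (o : Octagon I x l) : (incidenceGraph I).Walk (.inl x) (.inl x) :=
  consLine hxl o.a_mem_l <| consLine o.a_mem_k o.b_mem_k <| consLine o.b_mem_n o.y_mem_n <|
    consLine o.y_mem_m o.x_mem_m nil

theorem toWalk_isCycle (hxl : I x l) (o : Octagon I x l) : (o.toWalk hxl).IsCycle := by
  have hpoints := o.points_nodup
  have hlines := o.lines_nodup
  rw [isCycle_iff_isPath_tail_and_le_length]
  refine ⟨?_, by simp [toWalk]⟩
  simp only [toWalk, getVert_cons_succ, tail_cons, isPath_def, support_copy, support_cons,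
    support_nil, List.nodup_cons, List.mem_cons, Sum.inl.injEq, Sum.inr.injEq, reduceCtorEq]
  grind

theorem toWalk_injective (hxl : I x l) :
    Function.Injective (toWalk hxl : Octagon I x l → _) := by
  intro o o' h
  have := congrArg support h
  simp only [toWalk, support_cons, support_nil] at this
  grind [Octagon.ext]

theorem range_toWalk (hxl : I x l) : Set.range (toWalk hxl : Octagon I x l → _) =
    {w | w.IsCycle ∧ w.length = 8 ∧ w.snd = .inr l} := by
  ext w
  constructor
  · rintro ⟨o, rfl⟩
    exact ⟨o.toWalk_isCycle hxl, rfl, rfl⟩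
  · rintro ⟨hw, hlen, hsnd⟩
    have hnodup := hw.support_nodup
    obtain ⟨l', a, hxl', hal, w₆, rfl, hlen₆⟩ := exists_eq_consLine w hlen
    obtain ⟨k, b, hak, hbk, w₄, rfl, hlen₄⟩ := exists_eq_consLine w₆ hlen₆
    obtain ⟨n, y, hbn, hyn, w₂, rfl, hlen₂⟩ := exists_eq_consLine w₄ hlen₄
    obtain ⟨m, hym, hxm, rfl⟩ := exists_eq_consLine_nil w₂ hlen₂
    obtain rfl : l' = l := Sum.inr_injective hsnd
    simp only [support_cons, support_nil, List.tail_cons] at hnodup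
    exact ⟨⟨a, b, y, k, n, m, hal, hak, hbk, hbn, hyn, hym, hxm, by grind, by grind⟩, rfl⟩

end Octagon

theorem ncard_cyclesOfLength_eight_through {x : Pt} {l : Ln} (hxl : I x l) :
    {C ∈ cyclesOfLength (incidenceGraph I) 8 | s(.inl x, .inr l) ∈ C.edgeSet}.ncard =
      Nat.card (Octagon I x l) := by
  rw [ncard_cyclesOfLength_through, ← Octagon.range_toWalk hxl, ← Nat.card_coe_set_eq,
    Nat.card_range_of_injective (Octagon.toWalk_injective hxl)]

theorem ncard_neighborSet_inl (x : Pt) :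
    ((incidenceGraph I).neighborSet (.inl x)).ncard = {l | I x l}.ncard := by
  rw [← Set.ncard_image_of_injective {l | I x l} (Sum.inr_injective (α := Pt))]
  congr 1
  ext (y | l)
  · exact iff_of_false id (by simp)
  · simp [incidenceGraph]

theorem ncard_neighborSet_inr (l : Ln) :
    ((incidenceGraph I).neighborSet (.inr l)).ncard = {x | I x l}.ncard := by
  rw [← Set.ncard_image_of_injective {x | I x l} (Sum.inl_injective (β := Ln))]
  congr 1
  ext (x | m)
  · simp [incidenceGraph]
  · exact iff_of_false id (by simp)

theorem isEdgeGirthRegular_incidenceGraph [Finite Pt] [Finite Ln] (hI : NoTriangles I)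
    {n d lam : ℕ} (hpoints : Nat.card Pt = n) (hlines : Nat.card Ln = n)
    (hlines_through : ∀ x, {l | I x l}.ncard = d) (hpoints_on : ∀ l, {x | I x l}.ncard = d)
    (hoctagons : ∀ x l, I x l → Nat.card (Octagon I x l) = lam)
    (hexists : ∃ x l, I x l ∧ Nonempty (Octagon I x l)) :
    IsEdgeGirthRegular (incidenceGraph I) (2 * n) d 8 lam where
  finite := inferInstance
  order := by rw [Nat.card_sum, hpoints, hlines, two_mul]
  regular
    | .inl x => (ncard_neighborSet_inl x).trans (hlines_through x)
    | .inr l => (ncard_neighborSet_inr l).trans (hpoints_on l)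
  girth := by
    obtain ⟨x, l, hxl, ⟨o⟩⟩ := hexists
    exact le_antisymm (SimpleGraph.egirth_le_length (o.toWalk_isCycle hxl)) hI.eight_le_egirth
  cycles_through_edge e he := by
    induction e with
    | _ u v =>
      have hadj : (incidenceGraph I).Adj u v := he
      match u, v, hadj with
      | .inl x, .inr l, hxl =>
        exact (ncard_cyclesOfLength_eight_through (I := I) hxl).trans (hoctagons x l hxl)
      | .inr l, .inl x, hxl =>
        rw [Sym2.eq_swap]
        exact (ncard_cyclesOfLength_eight_through (I := I) hxl).trans (hoctagons x l hxl)

end Incidence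

section Geometry

variable {Pt : Type u} {Ln : Type v} {I : Pt → Ln → Prop} {s t : ℕ}

/-- Two points are opposite if no line contains both of them. Two lines `l` and `m` are opposite,
that is `IsOpposite (flip I) l m`, if they have no common point. -/
def IsOpposite (I : Pt → Ln → Prop) (x y : Pt) : Prop :=
  ∀ l, I x l → ¬ I y l

theorem not_isOpposite_iff {x y : Pt} : ¬ IsOpposite I x y ↔ ∃ l, I x l ∧ I y l := by
  simp only [IsOpposite, not_forall, not_not, exists_prop]

namespace IsGeneralizedQuadrangle

theorem exists_proj (h : IsGeneralizedQuadrangle I s t) {x : Pt} {l : Ln} (hxl : ¬ I x l) :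
    ∃ m y, I x m ∧ I y m ∧ I y l := by
  obtain ⟨⟨m, y⟩, hproj, -⟩ := h.existsUnique_proj x l hxl
  exact ⟨m, y, hproj⟩

theorem proj_unique (h : IsGeneralizedQuadrangle I s t) {x y y' : Pt} {l m m' : Ln}
    (hxl : ¬ I x l) (hxm : I x m) (hym : I y m) (hyl : I y l) (hxm' : I x m') (hym' : I y' m')
    (hyl' : I y' l) : m = m' ∧ y = y' :=
  Prod.mk.inj ((h.existsUnique_proj x l hxl).unique (y₁ := (m, y)) (y₂ := (m', y'))
    ⟨hxm, hym, hyl⟩ ⟨hxm', hym', hyl'⟩)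

protected theorem dual (h : IsGeneralizedQuadrangle I s t) :
    IsGeneralizedQuadrangle (flip I) t s where
  nonempty_points := h.nonempty_lines
  nonempty_lines := h.nonempty_points
  one_le_s := h.one_le_t
  one_le_t := h.one_le_s
  points_on_line := h.lines_through_point
  lines_through_point := h.points_on_line
  eq_or_eq l m x y hlx hmx hly hmy := (h.eq_or_eq x y l m hlx hly hmx hmy).symm
  existsUnique_proj l x hxl := by
    obtain ⟨m, y, hxm, hym, hyl⟩ := h.exists_proj hxl
    refine ⟨(y, m), ⟨hyl, hym, hxm⟩, ?_⟩
    rintro ⟨y', m'⟩ ⟨hyl', hym', hxm'⟩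
    obtain ⟨rfl, rfl⟩ := h.proj_unique hxl hxm hym hyl hxm' hym' hyl'
    rfl

theorem noTriangles (h : IsGeneralizedQuadrangle I s t) : NoTriangles I := by
  intro x y z l m n hxl hyl hym hzm hzn hxn
  by_cases hzl : I z l
  · have := h.eq_or_eq y z l m hyl hzl hym hzm
    have := h.eq_or_eq x z l n hxl hzl hxn hzn
    grind
  · exact .inl (h.proj_unique hzl hzn hxn hxl hzm hym hyl).2

theorem finite_points (h : IsGeneralizedQuadrangle I s t) : Finite Pt := by
  obtain ⟨l⟩ := h.nonempty_lines
  have hfinite_points (m : Ln) : {x | I x m}.Finite :=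
    Set.finite_of_ncard_ne_zero (by rw [h.points_on_line]; omega)
  have hfinite_lines (x : Pt) : {m | I x m}.Finite :=
    Set.finite_of_ncard_ne_zero (by rw [h.lines_through_point]; omega)
  refine Set.finite_univ_iff.1 (((hfinite_points l).biUnion fun y _ =>
    (hfinite_lines y).biUnion fun m _ => hfinite_points m).subset fun x _ => ?_)
  simp only [Set.mem_iUnion]
  by_cases hxl : I x l
  · exact ⟨x, hxl, l, hxl, hxl⟩
  · obtain ⟨m, y, hxm, hym, hyl⟩ := h.exists_proj hxl
    exact ⟨y, hyl, m, hym, hxm⟩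

theorem existsUnique_not_isOpposite_line (h : IsGeneralizedQuadrangle I s t) {x : Pt} {l : Ln}
    (hxl : ¬ I x l) : ∃! m, I x m ∧ ¬ IsOpposite (flip I) l m := by
  obtain ⟨m, y, hxm, hym, hyl⟩ := h.exists_proj hxl
  refine ⟨m, ⟨hxm, not_isOpposite_iff.2 ⟨y, hyl, hym⟩⟩, ?_⟩
  rintro m' ⟨hxm', hm'⟩
  obtain ⟨y', hyl', hym'⟩ := not_isOpposite_iff.1 hm'
  exact (h.proj_unique hxl hxm' hym' hyl' hxm hym hyl).1

theorem ncard_other_points_on (h : IsGeneralizedQuadrangle I s t) {x : Pt} {l : Ln}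
    (hxl : I x l) : {y | I y l ∧ y ≠ x}.ncard = s := by
  have hcard := Set.ncard_sdiff_singleton_of_mem (s := {y | I y l}) hxl
  rwa [h.points_on_line, Nat.add_sub_cancel] at hcard

theorem ncard_other_lines_through (h : IsGeneralizedQuadrangle I s t) {x : Pt} {l : Ln}
    (hxl : I x l) : {m | I x m ∧ m ≠ l}.ncard = t :=
  h.dual.ncard_other_points_on hxl

theorem ncard_isOpposite_lines_through (h : IsGeneralizedQuadrangle I s t) {x : Pt} {l : Ln}
    (hxl : ¬ I x l) : {m | IsOpposite (flip I) l m ∧ I x m}.ncard = t := by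
  obtain ⟨m₀, ⟨hxm₀, hm₀⟩, hunique⟩ := h.existsUnique_not_isOpposite_line hxl
  rw [← h.ncard_other_lines_through hxm₀]
  congr 1
  grind

theorem ncard_isOpposite_points_on (h : IsGeneralizedQuadrangle I s t) {x : Pt} {l : Ln}
    (hxl : ¬ I x l) : {y | IsOpposite I x y ∧ I y l}.ncard = s :=
  h.dual.ncard_isOpposite_lines_through hxl

theorem ncard_isOpposite (h : IsGeneralizedQuadrangle I s t) (P : Pt) :
    {x | IsOpposite I P x}.ncard = s * t * s := by
  have := h.finite_points
  have := h.dual.finite_points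
  obtain ⟨e, hPe⟩ : {l | I P l}.Nonempty :=
    Set.nonempty_of_ncard_ne_zero (by rw [h.lines_through_point]; omega)
  -- A point opposite to `P` lies on exactly one line `k` meeting `e`, and `k` meets `e` only once.
  let Z := {z | I z e ∧ z ≠ P}
  let K := {k | ¬ IsOpposite (flip I) e k ∧ ¬ I P k}
  have hZK : Z.ncard * t = K.ncard * 1 := by
    refine ncard_mul_eq_ncard_mul I (fun z ⟨hze, hzP⟩ => ?_) fun k ⟨hk, hPk⟩ =>
      Set.ncard_eq_one.2 ?_
    · rw [← h.ncard_other_lines_through hze]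
      congr 1
      ext k
      have hdegenerate := h.eq_or_eq z P k e
      simp only [K, not_isOpposite_iff, flip, Set.mem_ofPred_eq]
      grind
    · obtain ⟨z, (hze : I z e), (hzk : I z k)⟩ := not_isOpposite_iff.1 hk
      refine ⟨z, Set.ext fun z' => ?_⟩
      have hdegenerate := h.eq_or_eq z' z k e
      grind
  have hXK : {x | IsOpposite I P x}.ncard * 1 = K.ncard * s := by
    refine ncard_mul_eq_ncard_mul I (fun x hx => Set.ncard_eq_one.2 ?_) fun k hk =>
      h.ncard_isOpposite_points_on hk.2
    obtain ⟨k, ⟨hxk, hk⟩, hunique⟩ := h.existsUnique_not_isOpposite_line (l := e) (hx e hPe)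
    refine ⟨k, Set.ext fun k' => ?_⟩
    have hPk : ¬ I P k := fun hPk => hx k hPk hxk
    grind
  rw [← mul_one (Set.ncard _), hXK, ← mul_one K.ncard, ← hZK, h.ncard_other_points_on hPe]

end IsGeneralizedQuadrangle

/-- The type of points opposite to `P`. The lines opposite to `e` are `OppositeTo (flip I) e`. -/
abbrev OppositeTo (I : Pt → Ln → Prop) (P : Pt) : Type _ :=
  {x : Pt // IsOpposite I P x}

/-- The incidence relation between the points opposite to `P` and the lines opposite to `e`. -/
def oppositeIncidence (I : Pt → Ln → Prop) (P : Pt) (e : Ln) :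
    OppositeTo I P → OppositeTo (flip I) e → Prop :=
  fun x l => I x l

protected theorem NoTriangles.oppositeIncidence (hI : NoTriangles I) (P : Pt) (e : Ln) :
    NoTriangles (oppositeIncidence I P e) := by
  intro x y z l m n hxl hyl hym hzm hzn hxn
  simpa only [Subtype.ext_iff] using hI hxl hyl hym hzm hzn hxn

/-- The end points `a` and end lines `n` of the paths `a`, `l`, `x`, `m`, `y`, `n`. -/
def pathEnds (I : Pt → Ln → Prop) (x y : Pt) (l m : Ln) : Set (Pt × Ln) :=
  {p | IsIncidencePath I p.1 l x m y p.2}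

/-- The ends `a`, `n` of a path that is completed to an octagon of `I` by a line `k` not opposite
to `e`. -/
def lineObstructed (I : Pt → Ln → Prop) (P : Pt) (e : Ln) (x y : OppositeTo I P)
    (l m : OppositeTo (flip I) e) : Set (OppositeTo I P × OppositeTo (flip I) e) :=
  {p ∈ pathEnds (oppositeIncidence I P e) x y l m |
    ∃ k b, I p.1 k ∧ I b k ∧ I b p.2 ∧ ¬ IsOpposite (flip I) e k}

/-- The ends `a`, `n` of a path that is completed to an octagon of `I` by a point `b` not opposite
to `P`. -/
def pointObstructed (I : Pt → Ln → Prop) (P : Pt) (e : Ln) (x y : OppositeTo I P)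
    (l m : OppositeTo (flip I) e) : Set (OppositeTo I P × OppositeTo (flip I) e) :=
  {p ∈ pathEnds (oppositeIncidence I P e) x y l m |
    ∃ k b, I p.1 k ∧ I b k ∧ I b p.2 ∧ ¬ IsOpposite I P b}

namespace IsGeneralizedQuadrangle

section Degrees

variable {P : Pt} {e : Ln}

theorem card_oppositeTo (h : IsGeneralizedQuadrangle I s t) (P : Pt) :
    Nat.card (OppositeTo I P) = s * t * s :=
  h.ncard_isOpposite P

theorem ncard_oppositeIncidence_lines (h : IsGeneralizedQuadrangle I s t) (hPe : I P e)
    (x : OppositeTo I P) : {m | oppositeIncidence I P e x m}.ncard = t := by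
  rw [← h.ncard_isOpposite_lines_through (x.2 e hPe)]
  exact (Set.ncard_subtype _ {m | I x m}).trans (by rw [Set.inter_comm]; rfl)

theorem ncard_oppositeIncidence_points (h : IsGeneralizedQuadrangle I s t) (hPe : I P e)
    (l : OppositeTo (flip I) e) : {a | oppositeIncidence I P e a l}.ncard = s :=
  h.dual.ncard_oppositeIncidence_lines hPe l

theorem ncard_oppositeIncidence_other_points (h : IsGeneralizedQuadrangle I s t) (hPe : I P e)
    {x : OppositeTo I P} {l : OppositeTo (flip I) e} (hxl : oppositeIncidence I P e x l) :
    {a | oppositeIncidence I P e a l ∧ a ≠ x}.ncard = s - 1 := by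
  rw [← h.ncard_oppositeIncidence_points hPe l]
  exact Set.ncard_sdiff_singleton_of_mem (s := {a | oppositeIncidence I P e a l}) hxl

theorem ncard_oppositeIncidence_other_lines (h : IsGeneralizedQuadrangle I s t) (hPe : I P e)
    {x : OppositeTo I P} {l : OppositeTo (flip I) e} (hxl : oppositeIncidence I P e x l) :
    {m | oppositeIncidence I P e x m ∧ m ≠ l}.ncard = t - 1 :=
  h.dual.ncard_oppositeIncidence_other_points hPe hxl

end Degrees

section Obstructions

variable {P : Pt} {e : Ln} {x y : OppositeTo I P} {l m : OppositeTo (flip I) e}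

theorem not_mem_of_not_isOpposite (h : IsGeneralizedQuadrangle I s t)
    (hxl : oppositeIncidence I P e x l) (hxm : oppositeIncidence I P e x m)
    (hym : oppositeIncidence I P e y m) (hlm : l ≠ m) {a : OppositeTo I P}
    (hal : oppositeIncidence I P e a l) (hax : a ≠ x) {k : Ln} (hak : I a k)
    (hk : ¬ IsOpposite (flip I) e k) : ¬ I y k := by
  intro hyk
  obtain hxa | hlk | hlm' := h.noTriangles hxl hal hak hyk hym hxm
  · exact hax (Subtype.ext hxa.symm)
  · exact hk (hlk ▸ l.2)
  · exact hlm (Subtype.ext hlm')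

theorem injOn_fst_lineObstructed (h : IsGeneralizedQuadrangle I s t) (hPe : I P e) :
    Set.InjOn Prod.fst (lineObstructed I P e x y l m) := by
  rintro ⟨a, n⟩ ⟨hp, k, b, hak, hbk, hbn, hk⟩ ⟨a', n'⟩ ⟨hp', k', b', hak', hbk', hbn', hk'⟩
    (rfl : a = a')
  obtain rfl : k = k' :=
    (h.existsUnique_not_isOpposite_line (a.2 e hPe)).unique ⟨hak, hk⟩ ⟨hak', hk'⟩
  have hyk : ¬ I y k := h.not_mem_of_not_isOpposite hp.x_mem_l hp.x_mem_m hp.y_mem_m hp.l_ne_m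
    hp.a_mem_l hp.a_ne_x hak hk
  have hnn' := (h.proj_unique hyk hp.y_mem_n hbn hbk hp'.y_mem_n hbn' hbk').1
  exact Prod.ext rfl (Subtype.ext hnn')

theorem isOpposite_of_mem_lineObstructed (h : IsGeneralizedQuadrangle I s t) (hPe : I P e)
    {z : Pt} {r : Ln} (hyr : I y r) (hzr : I z r) (hze : I z e)
    {p : OppositeTo I P × OppositeTo (flip I) e} (hp : p ∈ lineObstructed I P e x y l m) :
    IsOpposite I z p.1 := by
  obtain ⟨a, n⟩ := p
  obtain ⟨hpath, k, b, hak, hbk, hbn, hk⟩ := hp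
  intro k' hzk' hak'
  obtain rfl : k' = k := (h.existsUnique_not_isOpposite_line (a.2 e hPe)).unique
    ⟨hak', not_isOpposite_iff.2 ⟨z, hze, hzk'⟩⟩ ⟨hak, hk⟩
  have hyk : ¬ I y k' := h.not_mem_of_not_isOpposite hpath.x_mem_l hpath.x_mem_m hpath.y_mem_m
    hpath.l_ne_m hpath.a_mem_l hpath.a_ne_x hak hk
  have hzn : ¬ I z n := n.2 z hze
  obtain rfl | rfl | rfl := h.noTriangles hbk hzk' hzr hyr hpath.y_mem_n hbn
  · exact hzn hbn
  · exact hyk hyr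
  · exact hzn hzk'

theorem exists_mem_lineObstructed (h : IsGeneralizedQuadrangle I s t) (hPe : I P e)
    (hxl : oppositeIncidence I P e x l) (hxm : oppositeIncidence I P e x m)
    (hym : oppositeIncidence I P e y m) (hxy : x ≠ y) (hlm : l ≠ m)
    {z : Pt} {r : Ln} (hyr : I y r) (hzr : I z r) (hze : I z e) {a : OppositeTo I P}
    (hal : oppositeIncidence I P e a l) (hax : a ≠ x) (hza : IsOpposite I z a) :
    ∃ n, (a, n) ∈ lineObstructed I P e x y l m := by
  obtain ⟨k, w, hak, hwk, hwe⟩ := h.exists_proj (a.2 e hPe)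
  have hk : ¬ IsOpposite (flip I) e k := not_isOpposite_iff.2 ⟨w, hwe, hwk⟩
  have hyk : ¬ I y k := h.not_mem_of_not_isOpposite hxl hxm hym hlm hal hax hak hk
  obtain ⟨n, b, hyn, hbn, hbk⟩ := h.exists_proj hyk
  have hwn : ¬ I w n := by
    intro hwn
    obtain ⟨-, rfl⟩ := h.proj_unique (y.2 e hPe) hyr hzr hze hyn hwn hwe
    exact hza k hwk hak
  have hn : IsOpposite (flip I) e n := by
    intro w' hwe' hwn'
    obtain rfl | rfl | rfl := h.noTriangles hwe' hwe hwk hbk hbn hwn'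
    · exact hwn hwn'
    · exact a.2 e hPe hak
    · exact y.2 e hPe hyn
  refine ⟨⟨n, hn⟩, ⟨hal, hxl, hxm, hym, hyn, hax, hlm, hxy, ?_⟩, k, b, hak, hbk, hbn, hk⟩
  rintro rfl
  obtain hxa | hlk | hlm' := h.noTriangles hxl hal hak hbk hbn hxm
  · exact hax (Subtype.ext hxa.symm)
  · exact hk (hlk ▸ l.2)
  · exact hlm (Subtype.ext hlm')

theorem ncard_isOpposite_proj (h : IsGeneralizedQuadrangle I s t) (hPe : I P e)
    (hxl : oppositeIncidence I P e x l) (hxm : oppositeIncidence I P e x m)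
    (hym : oppositeIncidence I P e y m) (hxy : x ≠ y) {z : Pt} {r : Ln} (hyr : I y r)
    (hzr : I z r) (hze : I z e) :
    {a | (oppositeIncidence I P e a l ∧ a ≠ x) ∧ IsOpposite I z a}.ncard = s - 2 := by
  have hzl : ¬ I z l := l.2 z hze
  have hzm : ¬ I z m := m.2 z hze
  obtain ⟨k, a₀, hzk, hak, hal⟩ := h.exists_proj hzl
  have haP : IsOpposite I P a₀ := by
    intro p hPp hap
    obtain rfl | rfl | rfl := h.noTriangles hPe hze hzk hak hap hPp
    · exact y.2 r hzr hyr
    · exact l.2 a₀ hak hal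
    · exact l.2 a₀ hap hal
  have hax : a₀ ≠ x := by
    rintro rfl
    obtain hxy' | rfl | rfl := h.noTriangles hxm hym hyr hzr hzk hak
    · exact hxy (Subtype.ext hxy')
    · exact hzm hzr
    · exact hzm hzk
  have heq : {a | (oppositeIncidence I P e a l ∧ a ≠ x) ∧ IsOpposite I z a} =
      {a | oppositeIncidence I P e a l ∧ a ≠ x} \ {⟨a₀, haP⟩} := by
    ext a
    refine and_congr_right fun ⟨hal', hax'⟩ => ⟨?_, fun hne k' hzk' hak' => hne ?_⟩
    · rintro hza rfl
      exact hza k hzk hak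
    · exact Subtype.ext (h.proj_unique hzl hzk' hak' hal' hzk hak hal).2
  have hmem : (⟨a₀, haP⟩ : OppositeTo I P) ∈ {a | oppositeIncidence I P e a l ∧ a ≠ x} :=
    ⟨hal, fun hax' => hax (congrArg Subtype.val hax')⟩
  rw [heq, Set.ncard_sdiff_singleton_of_mem hmem,
    h.ncard_oppositeIncidence_other_points hPe hxl, Nat.sub_sub]

theorem ncard_lineObstructed (h : IsGeneralizedQuadrangle I s t) (hPe : I P e)
    (hxl : oppositeIncidence I P e x l) (hxm : oppositeIncidence I P e x m)
    (hym : oppositeIncidence I P e y m) (hxy : x ≠ y) (hlm : l ≠ m) :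
    (lineObstructed I P e x y l m).ncard = s - 2 := by
  obtain ⟨r, z, hyr, hzr, hze⟩ := h.exists_proj (y.2 e hPe)
  rw [← h.ncard_isOpposite_proj hPe hxl hxm hym hxy hyr hzr hze,
    ← (h.injOn_fst_lineObstructed hPe).ncard_image]
  congr 1
  ext a
  constructor
  · rintro ⟨p, hp, rfl⟩
    exact ⟨⟨hp.1.a_mem_l, hp.1.a_ne_x⟩, h.isOpposite_of_mem_lineObstructed hPe hyr hzr hze hp⟩
  · rintro ⟨⟨hal, hax⟩, hza⟩
    obtain ⟨n, hn⟩ := h.exists_mem_lineObstructed hPe hxl hxm hym hxy hlm hyr hzr hze hal hax hza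
    exact ⟨(a, n), hn, rfl⟩

theorem ncard_pointObstructed (h : IsGeneralizedQuadrangle I s t) (hPe : I P e)
    (hxl : oppositeIncidence I P e x l) (hxm : oppositeIncidence I P e x m)
    (hym : oppositeIncidence I P e y m) (hxy : x ≠ y) (hlm : l ≠ m) :
    (pointObstructed I P e x y l m).ncard = t - 2 := by
  rw [← h.dual.ncard_lineObstructed (P := e) (e := P) hPe hym hxm hxl hlm.symm hxy.symm,
    ← Set.ncard_image_of_injective _ Prod.swap_injective, Set.image_swap_eq_preimage_swap]
  congr 1
  ext ⟨a, n⟩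
  constructor
  · rintro ⟨hp, k, b, hak, hbk, hbn, hb⟩
    exact ⟨hp.dual, b, k, hbn, hbk, hak, hb⟩
  · rintro ⟨hp, b, k, hbn, hbk, hak, hb⟩
    exact ⟨hp.dual, k, b, hak, hbk, hbn, hb⟩

theorem disjoint_obstructed (h : IsGeneralizedQuadrangle I s t) (hPe : I P e) :
    Disjoint (lineObstructed I P e x y l m) (pointObstructed I P e x y l m) := by
  rw [Set.disjoint_left]
  rintro ⟨a, n⟩ ⟨hp, k, b, hak, hbk, hbn, hk⟩ ⟨-, k', b', hak', hbk', hbn', hb'⟩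
  have han : ¬ I a n := hp.not_mem_ends (h.noTriangles.oppositeIncidence P e)
  obtain ⟨rfl, rfl⟩ := h.proj_unique han hak hbk hbn hak' hbk' hbn'
  obtain ⟨z, hze, hzk⟩ := not_isOpposite_iff.1 hk
  obtain ⟨p, hPp, hbp⟩ := not_isOpposite_iff.1 hb'
  obtain rfl | rfl | rfl := h.noTriangles hPe hze hzk hbk hbp hPp
  · exact a.2 k hzk hak
  · exact a.2 e hPe hak
  · exact n.2 b hbp hbn

end Obstructions

section Counts

variable {P : Pt} {e : Ln}

theorem ncard_pathEnds (h : IsGeneralizedQuadrangle I s t) (hPe : I P e)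
    {x y : OppositeTo I P} {l m : OppositeTo (flip I) e} (hxl : oppositeIncidence I P e x l)
    (hxm : oppositeIncidence I P e x m) (hym : oppositeIncidence I P e y m) (hxy : x ≠ y)
    (hlm : l ≠ m) : (pathEnds (oppositeIncidence I P e) x y l m).ncard = (s - 1) * (t - 1) := by
  have hprod : pathEnds (oppositeIncidence I P e) x y l m =
      {a | oppositeIncidence I P e a l ∧ a ≠ x} ×ˢ {n | oppositeIncidence I P e y n ∧ n ≠ m} := by
    ext ⟨a, n⟩
    exact ⟨fun hp => ⟨⟨hp.a_mem_l, hp.a_ne_x⟩, hp.y_mem_n, hp.m_ne_n.symm⟩,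
      fun ⟨⟨hal, hax⟩, hyn, hnm⟩ => ⟨hal, hxl, hxm, hym, hyn, hax, hlm, hxy, hnm.symm⟩⟩
  rw [hprod, Set.ncard_prod, h.ncard_oppositeIncidence_other_points hPe hxl,
    h.ncard_oppositeIncidence_other_lines hPe hym]

theorem two_le_of_ne (h : IsGeneralizedQuadrangle I s t) (hPe : I P e)
    {x y : OppositeTo I P} {m : OppositeTo (flip I) e} (hxm : oppositeIncidence I P e x m)
    (hym : oppositeIncidence I P e y m) (hxy : x ≠ y) : 2 ≤ s := by
  have := h.finite_points
  have hpos : 0 < {a | oppositeIncidence I P e a m ∧ a ≠ x}.ncard :=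
    Set.ncard_pos (Set.toFinite _) |>.2 ⟨y, hym, hxy.symm⟩
  rw [h.ncard_oppositeIncidence_other_points hPe hxm] at hpos
  omega

theorem ncard_unobstructed (h : IsGeneralizedQuadrangle I s t) (hPe : I P e)
    {x y : OppositeTo I P} {l m : OppositeTo (flip I) e} (hxl : oppositeIncidence I P e x l)
    (hxm : oppositeIncidence I P e x m) (hym : oppositeIncidence I P e y m) (hxy : x ≠ y)
    (hlm : l ≠ m) :
    (pathEnds (oppositeIncidence I P e) x y l m \
      (lineObstructed I P e x y l m ∪ pointObstructed I P e x y l m)).ncard =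
      (s - 2) * (t - 2) + 1 := by
  have := h.finite_points
  have := h.dual.finite_points
  obtain ⟨s, rfl⟩ := Nat.exists_eq_add_of_le' (h.two_le_of_ne hPe hxm hym hxy)
  obtain ⟨t, rfl⟩ := Nat.exists_eq_add_of_le' (h.dual.two_le_of_ne hPe hxl hxm hlm)
  have hsubset : lineObstructed I P e x y l m ∪ pointObstructed I P e x y l m ⊆
      pathEnds (oppositeIncidence I P e) x y l m :=
    Set.union_subset (Set.sep_subset _ _) (Set.sep_subset _ _)
  rw [Set.ncard_sdiff hsubset, Set.ncard_union_eq (h.disjoint_obstructed hPe),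
    h.ncard_pathEnds hPe hxl hxm hym hxy hlm, h.ncard_lineObstructed hPe hxl hxm hym hxy hlm,
    h.ncard_pointObstructed hPe hxl hxm hym hxy hlm, Nat.sub_eq_iff_eq_add (by grind)]
  simp only [Nat.add_sub_cancel, Nat.reduceSubDiff]
  ring

theorem not_obstructed_of_octagon (h : IsGeneralizedQuadrangle I s t) {x : OppositeTo I P}
    {l : OppositeTo (flip I) e} (hxl : oppositeIncidence I P e x l)
    (o : Octagon (oppositeIncidence I P e) x l) :
    (o.a, o.n) ∉ lineObstructed I P e x o.y l o.m ∪ pointObstructed I P e x o.y l o.m := by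
  have han : ¬ I o.a o.n :=
    (o.isIncidencePath hxl).not_mem_ends (h.noTriangles.oppositeIncidence P e)
  rintro (⟨-, k, b, hak, hbk, hbn, hk⟩ | ⟨-, k, b, hak, hbk, hbn, hb⟩)
  · obtain ⟨rfl, -⟩ := h.proj_unique han hak hbk hbn o.a_mem_k o.b_mem_k o.b_mem_n
    exact hk o.k.2
  · obtain ⟨-, rfl⟩ := h.proj_unique han hak hbk hbn o.a_mem_k o.b_mem_k o.b_mem_n
    exact hb o.b.2

theorem exists_octagon_of_not_obstructed (h : IsGeneralizedQuadrangle I s t)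
    {x y a : OppositeTo I P} {l m n : OppositeTo (flip I) e}
    (hp : IsIncidencePath (oppositeIncidence I P e) a l x m y n)
    (han : (a, n) ∉ lineObstructed I P e x y l m ∪ pointObstructed I P e x y l m) :
    ∃ o : Octagon (oppositeIncidence I P e) x l, (o.m = m ∧ o.y = y) ∧ (o.a, o.n) = (a, n) := by
  have hJ := h.noTriangles.oppositeIncidence P e
  obtain ⟨k, b, hak, hbk, hbn⟩ := h.exists_proj (hp.not_mem_ends hJ)
  have hk : IsOpposite (flip I) e k :=
    not_not.1 fun hk => han (.inl ⟨hp, k, b, hak, hbk, hbn, hk⟩)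
  have hb : IsOpposite I P b :=
    not_not.1 fun hb => han (.inr ⟨hp, k, b, hak, hbk, hbn, hb⟩)
  lift k to OppositeTo (flip I) e using hk
  lift b to OppositeTo I P using hb
  exact ⟨⟨a, b, y, k, n, m, hp.a_mem_l, hak, hbk, hbn, hp.y_mem_n, hp.y_mem_m, hp.x_mem_m,
    hp.points_nodup hJ hak hbk hbn, hp.lines_nodup hJ hak hbk hbn⟩, ⟨rfl, rfl⟩, rfl⟩

theorem octagon_eq (h : IsGeneralizedQuadrangle I s t) {x : OppositeTo I P}
    {l : OppositeTo (flip I) e} (hxl : oppositeIncidence I P e x l)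
    {o o' : Octagon (oppositeIncidence I P e) x l} (hm : o.m = o'.m) (hy : o.y = o'.y)
    (ha : o.a = o'.a) (hn : o.n = o'.n) : o = o' := by
  have han : ¬ I o.a o.n :=
    (o.isIncidencePath hxl).not_mem_ends (h.noTriangles.oppositeIncidence P e)
  obtain ⟨hk, hb⟩ := h.proj_unique han o.a_mem_k o.b_mem_k o.b_mem_n
    (ha ▸ o'.a_mem_k) o'.b_mem_k (hn ▸ o'.b_mem_n)
  exact Octagon.ext ha (Subtype.ext hb) hy (Subtype.ext hk) hn hm

theorem ncard_octagon_fiber (h : IsGeneralizedQuadrangle I s t) (hPe : I P e)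
    {x y : OppositeTo I P} {l m : OppositeTo (flip I) e} (hxl : oppositeIncidence I P e x l)
    (hxm : oppositeIncidence I P e x m) (hym : oppositeIncidence I P e y m) (hxy : x ≠ y)
    (hlm : l ≠ m) :
    {o : Octagon (oppositeIncidence I P e) x l | o.m = m ∧ o.y = y}.ncard =
      (s - 2) * (t - 2) + 1 := by
  rw [← h.ncard_unobstructed hPe hxl hxm hym hxy hlm]
  refine Set.ncard_congr (fun o _ => (o.a, o.n)) ?_ ?_ ?_
  · rintro o ⟨rfl, rfl⟩
    exact ⟨o.isIncidencePath hxl, h.not_obstructed_of_octagon hxl o⟩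
  · rintro o o' ⟨hm, hy⟩ ⟨hm', hy'⟩ hends
    obtain ⟨ha, hn⟩ := Prod.mk.inj hends
    exact h.octagon_eq hxl (hm.trans hm'.symm) (hy.trans hy'.symm) ha hn
  · rintro ⟨a, n⟩ ⟨hp, han⟩
    obtain ⟨o, ho, hends⟩ := h.exists_octagon_of_not_obstructed hp han
    exact ⟨o, ho, hends⟩

theorem card_octagon (h : IsGeneralizedQuadrangle I s t) (hPe : I P e) {x : OppositeTo I P}
    {l : OppositeTo (flip I) e} (hxl : oppositeIncidence I P e x l) :
    Nat.card (Octagon (oppositeIncidence I P e) x l) =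
      (t - 1) * ((s - 1) * ((s - 2) * (t - 2) + 1)) := by
  have := h.finite_points
  have := h.dual.finite_points
  rw [← Set.ncard_univ, ← h.ncard_oppositeIncidence_other_lines hPe hxl]
  refine ncard_eq_ncard_mul_of_fiber (f := Octagon.m)
    (fun o _ => ⟨o.x_mem_m, (o.isIncidencePath hxl).l_ne_m.symm⟩) fun m ⟨hxm, hml⟩ => ?_
  rw [← h.ncard_oppositeIncidence_other_points hPe hxm]
  refine ncard_eq_ncard_mul_of_fiber (f := Octagon.y) ?_ fun y ⟨hym, hyx⟩ => ?_
  · rintro o ⟨-, rfl⟩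
    exact ⟨o.y_mem_m, (o.isIncidencePath hxl).x_ne_y.symm⟩
  · simp only [Set.mem_univ, true_and, Set.mem_ofPred_eq]
    exact h.ncard_octagon_fiber hPe hxl hxm hym hyx.symm hml.symm

end Counts

end IsGeneralizedQuadrangle

theorem inl_mem_remaining {P x : Pt} {e : Ln} (hPe : I P e) :
    Sum.inl x ∈ remaining I P e ↔ IsOpposite I P x := by
  simp only [remaining, IsOpposite, Set.mem_ofPred_eq, Sum.inl.injEq, reduceCtorEq, false_and,
    exists_false, or_false, exists_eq_left', and_iff_right_iff_imp]
  rintro hx rfl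
  exact hx e hPe hPe

theorem inr_mem_remaining {P : Pt} {e m : Ln} :
    Sum.inr m ∈ remaining I P e ↔ IsOpposite (flip I) e m := by
  simp only [remaining, IsOpposite, flip, Set.mem_ofPred_eq, Sum.inr.injEq, reduceCtorEq,
    false_and, exists_false, false_or, exists_eq_left']

/-- The deleted graph is the incidence graph of the points opposite to `P` and the lines opposite
to `e`. -/
def deletedGraphIso {P : Pt} {e : Ln} (hPe : I P e) :
    deletedGraph I P e ≃g incidenceGraph (oppositeIncidence I P e) where
  toEquiv := Equiv.subtypeSum.trans <| Equiv.sumCongr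
    (Equiv.subtypeEquivRight fun _ => inl_mem_remaining hPe)
    (Equiv.subtypeEquivRight fun _ => inr_mem_remaining)
  map_rel_iff' := by
    rintro ⟨x | l, hu⟩ ⟨y | m, hv⟩ <;> rfl

theorem isEdgeGirthRegular_deletedGraph {q : ℕ} (hq : 2 ≤ q) (h : IsGeneralizedQuadrangle I q q)
    {P : Pt} {e : Ln} (hPe : I P e) :
    IsEdgeGirthRegular (deletedGraph I P e) (2 * q ^ 3) q 8
      ((q - 1) ^ 2 * ((q - 2) ^ 2 + 1)) := by
  have := h.finite_points
  have := h.dual.finite_points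
  refine (isEdgeGirthRegular_incidenceGraph (h.noTriangles.oppositeIncidence P e)
    ((h.card_oppositeTo P).trans (by ring)) ((h.dual.card_oppositeTo e).trans (by ring))
    (h.ncard_oppositeIncidence_lines hPe) (h.ncard_oppositeIncidence_points hPe)
    (fun x l hxl => (h.card_octagon hPe hxl).trans (by ring)) ?_).of_iso (deletedGraphIso hPe)
  have hcube : 0 < Nat.card (OppositeTo I P) := by
    rw [h.card_oppositeTo]
    positivity
  obtain ⟨x⟩ := (Nat.card_pos_iff.1 hcube).1
  obtain ⟨l, hxl⟩ : {l | oppositeIncidence I P e x l}.Nonempty :=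
    Set.nonempty_of_ncard_ne_zero (by rw [h.ncard_oppositeIncidence_lines hPe]; omega)
  refine ⟨x, l, hxl, (Nat.card_pos_iff.1 ?_).1⟩
  rw [h.card_octagon hPe hxl]
  have := Nat.sub_pos_of_lt hq
  positivity

end Geometry

theorem mainTheorem6 {Pt : Type u} {Ln : Type v} (I : Pt → Ln → Prop) (q : ℕ) (hq : 2 ≤ q)
    (hGQ : IsGeneralizedQuadrangle I q q) :
    (∀ (P : Pt) (e₀ : Ln), I P e₀ →
      IsEdgeGirthRegular (deletedGraph I P e₀)
        (2 * q ^ 3) q 8 ((q - 1) ^ 2 * ((q - 2) ^ 2 + 1))) ∧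
    (∃ (V : Type (max u v)) (G : SimpleGraph V),
      IsEdgeGirthRegular G (2 * q ^ 3) q 8 ((q - 1) ^ 2 * ((q - 2) ^ 2 + 1))) := by
  refine ⟨fun P e₀ => isEdgeGirthRegular_deletedGraph hq hGQ, ?_⟩
  obtain ⟨P⟩ := hGQ.nonempty_points
  obtain ⟨e₀, hPe₀⟩ : {l | I P l}.Nonempty :=
    Set.nonempty_of_ncard_ne_zero (by rw [hGQ.lines_through_point]; omega)
  exact ⟨_, _, isEdgeGirthRegular_deletedGraph hq hGQ hPe₀⟩
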